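/- Let $q$ be a prime power and let $\mathrm{AG}(3,q)$ be the $3$-dimensional affine space over the finite field $\mathbb{F}_q$. A line spread of $\mathrm{AG}(3,q)$ is a set of pairwise disjoint lines that partitions the point set of $\mathrm{AG}(3,q)$. A set $\mathcal{L}$ of lines of $\mathrm{AG}(3,q)$ is a Cameron-Liebler (CL) line class of parameter $x$ if $|\mathcal{L}\cap\mathcal{S}|=x$ for every line spread $\mathcal{S}$ of $\mathrm{AG}(3,q)$. Let $2(q+1)=p_1^{h_1}\cdots p_s^{h_s}$ be the prime factorization of $2(q+1)$, with $p_1,\dots,p_s$ distinct primes and all $h_i\ge 1$. Then every parameter $x$ of a CL line class in $\mathrm{AG}(3,q)$ satisfies $x\le q^2$, and the number of integers $x$ for which a CL line class of parameter $x$ exists in $\mathrm{AG}(3,q)$ is at most $$\begin{cases}2^{s-1}q, & \text{if } q \text{ is even},\\ 2^{s-1}q-2^{s-1}+2, & \text{if } q \text{ is odd}.\end{cases}$$ -/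

import Mathlib

/-- The point set of the affine space `AG(3,q)` over the field `F` with `q` elements. -/
abbrev AG3 (F : Type*) : Type _ := Fin 3 → F

/-- The lines of `AG(3,q)`: the nonempty affine subspaces of dimension one. -/
def IsAffineLine {F : Type*} [Field F] (l : AffineSubspace F (AG3 F)) : Prop :=
  (l : Set (AG3 F)).Nonempty ∧ Module.finrank F l.direction = 1

/-- A partial line spread: a set of pairwise disjoint lines (disjoint as point sets, so
parallel lines are disjoint). -/
def IsPartialLineSpread {F : Type*} [Field F] (S : Set (AffineSubspace F (AG3 F))) : Prop :=
  (∀ l ∈ S, IsAffineLine l) ∧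
    ∀ l ∈ S, ∀ m ∈ S, l ≠ m → Disjoint (l : Set (AG3 F)) (m : Set (AG3 F))

/-- A line spread: a partial line spread that partitions the points. -/
def IsLineSpread {F : Type*} [Field F] (S : Set (AffineSubspace F (AG3 F))) : Prop :=
  IsPartialLineSpread S ∧ ∀ P : AG3 F, ∃ l ∈ S, P ∈ l

/-- A Cameron-Liebler line class of parameter `x` in `AG(3,q)`: a set of lines meeting every
line spread in exactly `x` lines. -/
def IsCLLineClass {F : Type*} [Field F] (L : Set (AffineSubspace F (AG3 F))) (x : ℕ) : Prop :=
  (∀ l ∈ L, IsAffineLine l) ∧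
    ∀ S : Set (AffineSubspace F (AG3 F)), IsLineSpread S → (L ∩ S).ncard = x

/-- The set of all `x` for which a Cameron-Liebler line class of parameter `x` exists in
`AG(3,q)`. -/
def clParameters (F : Type*) [Field F] : Set ℕ :=
  {x | ∃ L : Set (AffineSubspace F (AG3 F)), IsCLLineClass L x}

/-! A parallel class is a spread, so x ≤ q². The parameter also satisfies 2(q+1) ∣ x(x-1).
Redirecting a parallel class inside one plane gives another spread, so the plane w = c contains the
same number n(w,c) of class lines in each of its directions (`ncard_plane_eq`). Counting pairs of
points on class lines of one direction, within each plane, gives (q+1) Σ n² = (q³-1) x(x+q), while Σ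
n = (q³-1) x. Subtracting, 2(q+1) Σ C(n,2) = (q³-1) x(x-1). Each plane comes from q-1 pairs (w,c),
so q-1 cancels, leaving the factor q²+q+1, which is coprime to 2(q+1).

Hence x is 0 or 1 modulo each prime power of 2(q+1), and the Chinese remainder theorem bounds the
admissible x in each block of consecutive integers. -/

/-- The line through `P` with direction vector `v`. -/
def lineThrough {F : Type*} [Field F] (P v : AG3 F) : AffineSubspace F (AG3 F) :=
  AffineSubspace.mk' P (Submodule.span F {v})

/-! ### Lines, spreads from vector fields, and counts in planes -/

section Lines

variable {F : Type*} [Field F]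

theorem mem_lineThrough {P Q v : AG3 F} : Q ∈ lineThrough P v ↔ ∃ t : F, t • v = Q - P := by
  rw [lineThrough, AffineSubspace.mem_mk', Submodule.mem_span_singleton]
  rfl

theorem self_mem_lineThrough (P v : AG3 F) : P ∈ lineThrough P v :=
  mem_lineThrough.2 ⟨0, by simp⟩

theorem lineThrough_eq_of_mem {P Q v : AG3 F} (h : Q ∈ lineThrough P v) :
    lineThrough Q v = lineThrough P v := by
  obtain ⟨t, ht⟩ := mem_lineThrough.1 h
  ext R
  rw [mem_lineThrough, mem_lineThrough]
  constructor
  · rintro ⟨r, hr⟩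
    exact ⟨r + t, by rw [add_smul, hr, ht]; abel⟩
  · rintro ⟨r, hr⟩
    exact ⟨r - t, by rw [sub_smul, hr, ht]; abel⟩

theorem isAffineLine_lineThrough (P : AG3 F) {v : AG3 F} (hv : v ≠ 0) :
    IsAffineLine (lineThrough P v) :=
  ⟨⟨P, self_mem_lineThrough P v⟩, by
    rw [lineThrough, AffineSubspace.direction_mk', finrank_span_singleton hv]⟩

theorem IsAffineLine.ncard_coe {l : AffineSubspace F (AG3 F)} (hl : IsAffineLine l) :
    (l : Set (AG3 F)).ncard = Nat.card F := by
  obtain ⟨⟨P, hP⟩, h1⟩ := hl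
  obtain ⟨v, hv, hspan⟩ := finrank_eq_one_iff'.1 h1
  have hv0 : (v : AG3 F) ≠ 0 := fun h => hv (Subtype.ext h)
  have hset : (l : Set (AG3 F)) = (fun t : F => t • (v : AG3 F) + P) '' Set.univ := by
    ext Q
    simp only [SetLike.mem_coe, Set.image_univ, Set.mem_range]
    constructor
    · intro hQ
      obtain ⟨t, ht⟩ := hspan ⟨Q -ᵥ P, AffineSubspace.vsub_mem_direction hQ hP⟩
      refine ⟨t, ?_⟩
      have := congrArg Subtype.val ht
      simp only [Submodule.coe_smul, vsub_eq_sub] at this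
      rw [this, sub_add_cancel]
    · rintro ⟨t, rfl⟩
      exact AffineSubspace.vadd_mem_of_mem_direction (l.direction.smul_mem t v.2) hP
  rw [hset, Set.ncard_image_of_injective, Set.ncard_univ]
  intro a b hab
  exact smul_left_injective F hv0 (add_right_cancel hab)

/-- A nonvanishing vector field, constant along the lines it spans, gives a line spread. -/
theorem isLineSpread_range_lineThrough {D : AG3 F → AG3 F} (hD : ∀ P, D P ≠ 0)
    (hconst : ∀ P, ∀ t : F, D (P + t • D P) = D P) :
    IsLineSpread (Set.range fun P => lineThrough P (D P)) := by
  have key : ∀ P R, R ∈ lineThrough P (D P) → lineThrough R (D R) = lineThrough P (D P) := by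
    intro P R h
    obtain ⟨t, ht⟩ := mem_lineThrough.1 h
    have : R = P + t • D P := by rw [ht]; abel
    have hDR : D R = D P := by rw [this, hconst]
    rw [hDR]
    exact lineThrough_eq_of_mem h
  refine ⟨⟨?_, ?_⟩, fun P => ⟨_, ⟨P, rfl⟩, self_mem_lineThrough _ _⟩⟩
  · rintro _ ⟨P, rfl⟩
    exact isAffineLine_lineThrough P (hD P)
  · rintro _ ⟨P, rfl⟩ _ ⟨Q, rfl⟩ hne
    rw [Set.disjoint_left]
    intro R h1 h2
    exact hne ((key P R h1).symm.trans (key Q R h2))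

variable [Finite F]

instance : Finite (AffineSubspace F (AG3 F)) :=
  Finite.of_injective (fun l => (l : Set (AG3 F))) SetLike.coe_injective

/-- Pairwise disjoint lines cover `q` points each. -/
theorem ncard_points_of_isPartialLineSpread {S : Set (AffineSubspace F (AG3 F))}
    (hS : IsPartialLineSpread S) :
    {P : AG3 F | ∃ l ∈ S, P ∈ l}.ncard = Nat.card F * S.ncard := by
  classical
  have hfin := S.toFinite
  have hset : {P : AG3 F | ∃ l ∈ S, P ∈ l} =
      ((hfin.toFinset.biUnion fun l => (Set.toFinite (l : Set (AG3 F))).toFinset :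
        Finset (AG3 F)) : Set (AG3 F)) := by
    ext P; simp
  rw [hset, Set.ncard_coe_finset, Finset.card_biUnion, Set.ncard_eq_toFinset_card S hfin,
    mul_comm, Finset.sum_const_nat]
  · intro l hl
    rw [← Set.ncard_eq_toFinset_card]
    exact (hS.1 l (by simpa using hl)).ncard_coe
  · intro l hl m hm hlm
    have := hS.2 l (by simpa using hl) m (by simpa using hm) hlm
    rw [Function.onFun, ← Finset.disjoint_coe]
    simpa using this

/-- Counting points instead of lines (hence the factor q) lets different spreads be compared point
by point. -/
theorem IsCLLineClass.ncard_vectorField {L : Set (AffineSubspace F (AG3 F))} {x : ℕ}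
    (hL : IsCLLineClass L x) {D : AG3 F → AG3 F} (hD : ∀ P, D P ≠ 0)
    (hconst : ∀ P, ∀ t : F, D (P + t • D P) = D P) :
    {P | lineThrough P (D P) ∈ L}.ncard = Nat.card F * x := by
  have hS := isLineSpread_range_lineThrough hD hconst
  rw [← hL.2 _ hS, ← ncard_points_of_isPartialLineSpread
    ⟨fun l hl => hL.1 l hl.1, fun l hl m hm => hS.1.2 l hl.2 m hm.2⟩]
  congr 1
  ext P
  constructor
  · intro h
    exact ⟨_, ⟨h, ⟨P, rfl⟩⟩, self_mem_lineThrough _ _⟩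
  · rintro ⟨l, ⟨hl, hlS⟩, hP⟩
    by_cases h : lineThrough P (D P) = l
    · exact (congrArg (· ∈ L) h).mpr hl
    · exact absurd hP (Set.disjoint_left.1 (hS.1.2 _ ⟨P, rfl⟩ l hlS h) (self_mem_lineThrough _ _))

theorem IsCLLineClass.ncard_direction {L : Set (AffineSubspace F (AG3 F))} {x : ℕ}
    (hL : IsCLLineClass L x) {v : AG3 F} (hv : v ≠ 0) :
    {P | lineThrough P v ∈ L}.ncard = Nat.card F * x :=
  hL.ncard_vectorField (D := fun _ => v) (fun _ => hv) fun _ _ => rfl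

theorem IsCLLineClass.le_card_sq {L : Set (AffineSubspace F (AG3 F))} {x : ℕ}
    (hL : IsCLLineClass L x) : x ≤ Nat.card F ^ 2 := by
  have h := hL.ncard_direction (v := fun _ => 1) (fun h => one_ne_zero (congrFun h 0))
  have hle : {P : AG3 F | lineThrough P (fun _ => 1) ∈ L}.ncard ≤ Nat.card (AG3 F) :=
    Set.ncard_le_card _
  have hc : Nat.card (AG3 F) = Nat.card F ^ 3 := by simp [AG3, Nat.card_fun]
  rw [h, hc] at hle
  have hpos : 0 < Nat.card F := Nat.card_pos
  exact Nat.le_of_mul_le_mul_left (by linarith [pow_succ' (Nat.card F) 2]) hpos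

/-- In a plane, all parallel classes of lines have the same number of members in a
Cameron-Liebler line class. -/
theorem IsCLLineClass.ncard_plane_eq {L : Set (AffineSubspace F (AG3 F))} {x : ℕ}
    (hL : IsCLLineClass L x) {w : Module.Dual F (AG3 F)} (c : F) {v v' : AG3 F}
    (hv : v ≠ 0) (hv' : v' ≠ 0) (hwv : w v = 0) (hwv' : w v' = 0) :
    {P | w P = c ∧ lineThrough P v ∈ L}.ncard = {P | w P = c ∧ lineThrough P v' ∈ L}.ncard := by
  classical
  have h1 := hL.ncard_direction hv
  -- Both directions lie in ker w, so no line leaves its plane and the switched field is constant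
  -- along its lines.
  have h2 := hL.ncard_vectorField (D := fun P => if w P = c then v' else v)
    (fun P => by split_ifs <;> assumption)
    (fun P t => by
      by_cases h : w P = c
      · simp [h, hwv']
      · simp [h, hwv])
  have split : ∀ u : AG3 F, ∀ D : AG3 F → AG3 F, (∀ P, w P = c → D P = u) →
      (∀ P, w P ≠ c → D P = v) → {P | lineThrough P (D P) ∈ L}.ncard =
        {P | w P = c ∧ lineThrough P u ∈ L}.ncard +
          {P | w P ≠ c ∧ lineThrough P v ∈ L}.ncard := by
    intro u D hu hD
    rw [← Set.ncard_union_eq]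
    · congr 1
      ext P
      by_cases h : w P = c
      · simp [h, hu P h]
      · simp [h, hD P h]
    · rw [Set.disjoint_left]
      exact fun P hP hP' => hP'.1 hP.1
  rw [split v (fun _ => v) (fun _ _ => rfl) fun _ _ => rfl] at h1
  rw [split v' _ (fun P h => if_pos h) fun P h => if_neg h] at h2
  omega

theorem card_dvd_ncard_plane {L : Set (AffineSubspace F (AG3 F))} {w : Module.Dual F (AG3 F)}
    (c : F) {v : AG3 F} (hv : v ≠ 0) (hwv : w v = 0) :
    Nat.card F ∣ {P | w P = c ∧ lineThrough P v ∈ L}.ncard := by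
  have hS := isLineSpread_range_lineThrough (D := fun _ => v) (fun _ => hv) fun _ _ => rfl
  refine ⟨({l | (l ∈ Set.range fun P => lineThrough P v) ∧ l ∈ L ∧ ∀ P ∈ l, w P = c}).ncard, ?_⟩
  rw [← ncard_points_of_isPartialLineSpread
    ⟨fun l hl => hS.1.1 l hl.1, fun l hl m hm => hS.1.2 l hl.1 m hm.1⟩]
  congr 1
  ext P
  constructor
  · rintro ⟨h, h'⟩
    refine ⟨_, ⟨⟨P, rfl⟩, h', fun Q hQ => ?_⟩, self_mem_lineThrough _ _⟩
    obtain ⟨t, ht⟩ := mem_lineThrough.1 hQ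
    have : Q = P + t • v := by rw [ht]; abel
    simp [this, hwv, h]
  · rintro ⟨_, ⟨⟨Q, rfl⟩, hL, h⟩, hP⟩
    refine ⟨h P hP, ?_⟩
    rw [lineThrough_eq_of_mem hP]
    exact hL

end Lines

/-! ### Counting solutions of the congruence -/

section Arithmetic

/-- Since x and x-1 are coprime, the set of primes dividing x fixes x modulo the product, hence
modulo m; the quotient x / m fixes the block. Allowing m to be a proper divisor of the product
avoids computing it. -/
theorem card_le_of_forall_pow_dvd {ι : Type*} (t : Finset ι) (p h : ι → ℕ)
    (hp : ∀ i ∈ t, (p i).Prime) (hinj : Set.InjOn p t)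
    {m : ℕ} (hmt : m ∣ ∏ i ∈ t, p i ^ h i) (k : ℕ) (A : Finset ℕ)
    (hA : ∀ x ∈ A, x < m * k ∧ ∀ i ∈ t, p i ^ h i ∣ x * (x - 1)) :
    A.card ≤ k * 2 ^ t.card := by
  classical
  have hcard : (Finset.range k ×ˢ t.powerset).card = k * 2 ^ t.card := by
    rw [Finset.card_product, Finset.card_range, Finset.card_powerset]
  rw [← hcard]
  refine Finset.card_le_card_of_injOn (fun x => (x / m, t.filter fun i => p i ∣ x)) ?_ ?_
  · intro x hx
    simp only [Finset.coe_product, Set.mem_prod, Finset.mem_coe, Finset.mem_range,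
      Finset.mem_powerset]
    exact ⟨Nat.div_lt_of_lt_mul (hA x hx).1, Finset.filter_subset _ _⟩
  · intro x hx y hy hxy
    simp only [Prod.mk.injEq] at hxy
    obtain ⟨hdiv, hfil⟩ := hxy
    have key : ∀ z ∈ A, ∀ i ∈ t, (p i ∣ z → z ≡ 0 [MOD p i ^ h i]) ∧
        (¬ p i ∣ z → z ≡ 1 [MOD p i ^ h i]) := by
      intro z hz i hi
      have hd := (hA z hz).2 i hi
      constructor
      · intro hpz
        rcases Nat.eq_zero_or_pos z with rfl | hz0
        · rfl
        have hcop : Nat.Coprime (p i ^ h i) (z - 1) := by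
          refine Nat.Coprime.pow_left _ (((hp i hi).coprime_iff_not_dvd).2 fun h1 => ?_)
          have : p i ∣ z - (z - 1) := Nat.dvd_sub hpz h1
          rw [Nat.sub_sub_self hz0] at this
          exact (hp i hi).one_lt.ne' (Nat.dvd_one.1 this)
        exact (Nat.modEq_zero_iff_dvd).2 (hcop.dvd_of_dvd_mul_right hd)
      · intro hpz
        have hz0 : 1 ≤ z := Nat.one_le_iff_ne_zero.2 fun h0 => hpz (h0 ▸ dvd_zero _)
        have hcop : Nat.Coprime (p i ^ h i) z :=
          Nat.Coprime.pow_left _ (((hp i hi).coprime_iff_not_dvd).2 hpz)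
        exact ((Nat.modEq_iff_dvd' hz0).2 (hcop.dvd_of_dvd_mul_left hd)).symm
    have hmod : ∀ i ∈ t, x ≡ y [MOD p i ^ h i] := by
      intro i hi
      have hiff : p i ∣ x ↔ p i ∣ y := by
        have := congrArg (i ∈ ·) hfil
        simpa [hi] using this
      by_cases hpx : p i ∣ x
      · exact ((key x hx i hi).1 hpx).trans ((key y hy i hi).1 (hiff.1 hpx)).symm
      · exact ((key x hx i hi).2 hpx).trans ((key y hy i hi).2 (mt hiff.2 hpx)).symm
    have hprod : (∏ i ∈ t, ((p i ^ h i : ℕ) : ℤ)) ∣ (y : ℤ) - x := by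
      refine Finset.prod_dvd_of_coprime ?_ fun i hi => (Nat.modEq_iff_dvd.1 (hmod i hi))
      intro i hi j hj hij
      refine Nat.isCoprime_iff_coprime.2 (Nat.Coprime.pow _ _ ?_)
      exact (Nat.coprime_primes (hp i hi) (hp j hj)).2 fun e => hij (hinj hi hj e)
    have hxm : x % m = y % m := by
      refine Nat.modEq_iff_dvd.2 (dvd_trans ?_ hprod)
      rw [← Nat.cast_prod]
      exact_mod_cast hmt
    rw [← Nat.div_add_mod x m, ← Nat.div_add_mod y m, hdiv, hxm]

theorem card_le_card_filter_lt_add_two (A : Finset ℕ) (m : ℕ) (hA : ∀ x ∈ A, x ≤ m + 1) :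
    A.card ≤ (A.filter (· < m)).card + 2 := by
  rw [← Finset.card_filter_add_card_filter_not (s := A) (· < m)]
  refine Nat.add_le_add_left ?_ _
  have : A.filter (fun x => ¬ x < m) ⊆ {m, m + 1} := by
    intro x hx
    have h := Finset.mem_filter.1 hx
    have := hA x h.1
    simp only [Finset.mem_insert, Finset.mem_singleton]
    omega
  exact (Finset.card_le_card this).trans Finset.card_le_two

theorem card_le_of_two_mul_succ_dvd {q s : ℕ} (hq : 1 < q) (p h : Fin s → ℕ)
    (hp : ∀ i, (p i).Prime) (hinj : Function.Injective p)
    (hfac : 2 * (q + 1) = ∏ i, p i ^ h i) (A : Finset ℕ)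
    (hA : ∀ x ∈ A, x ≤ q ^ 2 ∧ 2 * (q + 1) ∣ x * (x - 1)) :
    A.card ≤ 2 ^ (s - 1) * (q - 1) + 2 ∧ (Even q → 1 < s) := by
  classical
  -- Only q²-1 and q² lie beyond the complete blocks; they account for the +2.
  have hsq : q ^ 2 = (q + 1) * (q - 1) + 1 := by
    obtain ⟨r, rfl⟩ := Nat.exists_eq_add_of_lt hq
    simp only [Nat.add_sub_cancel]
    ring
  have hsplit := card_le_card_filter_lt_add_two A ((q + 1) * (q - 1))
    fun x hx => hsq ▸ (hA x hx).1
  have hpow : ∀ x ∈ A, ∀ i, p i ^ h i ∣ x * (x - 1) := fun x hx i =>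
    (hfac ▸ Finset.dvd_prod_of_mem (fun i => p i ^ h i) (Finset.mem_univ i)).trans (hA x hx).2
  obtain ⟨i₀, hi₀⟩ : ∃ i, p i = 2 := by
    have h2 : 2 ∣ ∏ i, p i ^ h i := ⟨_, hfac.symm⟩
    obtain ⟨i, -, hi⟩ := (Nat.prime_two.prime.dvd_finsetProd_iff _).1 h2
    exact ⟨i, ((Nat.prime_dvd_prime_iff_eq Nat.prime_two (hp i)).1
      (Nat.prime_two.dvd_of_dvd_pow hi)).symm⟩
  have hs : 0 < s := i₀.pos
  rcases Nat.even_or_odd q with he | ho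
  -- For even q the prime 2 carries no information, as x(x-1) is always even: use q-1 blocks of
  -- length q+1 and s-1 primes.
  · have hcop : Nat.Coprime (q + 1) (p i₀ ^ h i₀) := by
      rw [hi₀]
      exact Nat.Coprime.pow_right _ (Nat.coprime_two_right.2 he.add_one)
    have hdvd : q + 1 ∣ ∏ i ∈ Finset.univ.erase i₀, p i ^ h i := by
      refine hcop.dvd_of_dvd_mul_left ?_
      rw [Finset.mul_prod_erase _ (fun i => p i ^ h i) (Finset.mem_univ i₀), ← hfac]
      exact Dvd.intro_left _ rfl
    have hc : (Finset.univ.erase i₀).card = s - 1 := by simp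
    have := card_le_of_forall_pow_dvd _ p h (fun i _ => hp i) hinj.injOn
      hdvd (q - 1) (A.filter (· < (q + 1) * (q - 1))) fun x hx =>
        ⟨(Finset.mem_filter.1 hx).2, fun i _ => hpow x (Finset.mem_filter.1 hx).1 i⟩
    rw [hc] at this
    refine ⟨by linarith, fun _ => ?_⟩
    by_contra hs1
    have h0 : Finset.univ.erase i₀ = ∅ := Finset.card_eq_zero.1 (by omega)
    rw [h0, Finset.prod_empty, Nat.dvd_one] at hdvd
    omega
  · obtain ⟨r, rfl⟩ := ho
    refine ⟨?_, fun he => absurd he (by simp)⟩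
    have e : 2 * r + 1 - 1 = 2 * r := rfl
    rw [e] at hsplit ⊢
    -- For odd q = 2r+1, q²-1 splits into r blocks of length 2(q+1), each with at most 2^s
    -- solutions.
    have := card_le_of_forall_pow_dvd Finset.univ p h (fun i _ => hp i) hinj.injOn
      (m := 2 * (2 * r + 1 + 1)) hfac.dvd r
      (A.filter (· < (2 * r + 1 + 1) * (2 * r))) fun x hx =>
        ⟨(Finset.mem_filter.1 hx).2.trans_eq (by ring), fun i _ =>
          hpow x (Finset.mem_filter.1 hx).1 i⟩
    rw [Finset.card_univ, Fintype.card_fin] at this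
    obtain ⟨s, rfl⟩ := Nat.exists_eq_add_of_lt hs
    have e2 : 0 + s + 1 - 1 = s := by omega
    rw [e2]
    have : r * 2 ^ (0 + s + 1) = 2 ^ s * (2 * r) := by rw [zero_add, pow_succ]; ring
    linarith

end Arithmetic

/-! ### Counting functionals, and orbits under scaling -/

section Counting

theorem card_AG3 {F : Type*} : Nat.card (AG3 F) = Nat.card F ^ 3 := by simp [AG3, Nat.card_fun]

variable {F : Type*} [Field F]

theorem ncard_ker {w : Module.Dual F (AG3 F)} (hw : w ≠ 0) :
    {v | w v = 0}.ncard = Nat.card F ^ 2 := by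
  have h : Nat.card (LinearMap.ker w) = Nat.card F ^ 2 := by
    rw [Module.natCard_eq_pow_finrank (K := F)]
    have h1 := LinearMap.finrank_range_add_finrank_ker w
    rw [LinearMap.range_eq_top.2 (LinearMap.surjective hw), finrank_top,
      Module.finrank_self, Module.finrank_fin_fun] at h1
    congr 1
    omega
  rw [← h, ← Nat.card_coe_set_eq]
  rfl

theorem ncard_annihilator_pair (v u : AG3 F) :
    {w : Module.Dual F (AG3 F) | w v = 0 ∧ w u = 0}.ncard =
      Nat.card F ^ (3 - Module.finrank F (Submodule.span F {v, u})) := by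
  have h1 := Subspace.finrank_add_finrank_dualAnnihilator_eq (Submodule.span F {v, u})
  rw [Module.finrank_fin_fun] at h1
  rw [show 3 - Module.finrank F (Submodule.span F {v, u}) =
    Module.finrank F (Submodule.span F {v, u}).dualAnnihilator by omega,
    ← Module.natCard_eq_pow_finrank (K := F)
      (V := (Submodule.span F {v, u}).dualAnnihilator), ← Nat.card_coe_set_eq]
  refine Nat.card_congr (Equiv.setCongr ?_)
  ext w
  constructor
  · rintro ⟨h, h'⟩
    refine (Submodule.mem_dualAnnihilator w).2 fun z hz => ?_
    obtain ⟨a, b, rfl⟩ := Submodule.mem_span_pair.1 hz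
    simp [h, h']
  · intro h
    have h' := (Submodule.mem_dualAnnihilator w).1 h
    exact ⟨h' v (Submodule.subset_span (by simp)), h' u (Submodule.subset_span (by simp))⟩

theorem ncard_annihilator_pair_of_mem {v u : AG3 F} (hv : v ≠ 0) (hu : ∃ t : F, t • v = u) :
    {w : Module.Dual F (AG3 F) | w v = 0 ∧ w u = 0}.ncard = Nat.card F ^ 2 := by
  obtain ⟨t, rfl⟩ := hu
  rw [ncard_annihilator_pair]
  have : Submodule.span F {v, t • v} = Submodule.span F {v} := by
    rw [Set.pair_comm, Submodule.span_insert_eq_span]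
    exact Submodule.smul_mem _ _ (Submodule.mem_span_singleton_self v)
  rw [this, finrank_span_singleton hv]

theorem ncard_annihilator_pair_of_notMem {v u : AG3 F} (hv : v ≠ 0) (hu : ¬ ∃ t : F, t • v = u) :
    {w : Module.Dual F (AG3 F) | w v = 0 ∧ w u = 0}.ncard = Nat.card F := by
  rw [ncard_annihilator_pair]
  have hli : LinearIndependent F ![v, u] :=
    (LinearIndependent.pair_iff' hv).2 fun a ha => hu ⟨a, ha⟩
  have := finrank_span_eq_card hli
  rw [Matrix.range_cons, Matrix.range_cons, Matrix.range_empty, Set.union_empty,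
    Set.singleton_union, Fintype.card_fin] at this
  rw [this, pow_one]

variable [Finite F]

/-- Sums of scaling-invariant functions over nonzero vectors are divisible by `q - 1`. -/
theorem card_sub_one_dvd_sum {V : Type*} [AddCommGroup V] [Module F V] [Fintype V]
    [DecidableEq V] (G : V → ℤ) (hG : ∀ (a : Fˣ) w, G (a • w) = G w) :
    ((Nat.card F : ℤ) - 1) ∣ ∑ w ∈ Finset.univ.erase (0 : V), G w := by
  classical
  have := Fintype.ofFinite F
  -- Group nonzero vectors by the line they span: each group is a free orbit of `Fˣ`, of size q-1.
  rw [← Finset.sum_fiberwise_of_maps_to (t := (Finset.univ.erase (0 : V)).image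
    fun w => Submodule.span F {w}) fun w hw => Finset.mem_image_of_mem _ hw]
  refine Finset.dvd_sum fun U hU => ?_
  obtain ⟨w, hw, rfl⟩ := Finset.mem_image.1 hU
  have hw0 : w ≠ 0 := (Finset.mem_erase.1 hw).1
  have hset : ((Finset.univ.erase (0 : V)).filter
      fun u => Submodule.span F {u} = Submodule.span F {w}) =
      (Finset.univ : Finset Fˣ).image fun a => a • w := by
    ext u
    simp only [Finset.mem_filter, Finset.mem_erase, Finset.mem_univ, and_true, Finset.mem_image,
      true_and]
    constructor
    · rintro ⟨-, h⟩
      exact Submodule.span_singleton_eq_span_singleton.1 h.symm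
    · rintro ⟨a, rfl⟩
      exact ⟨(smul_ne_zero_iff_ne a).2 hw0,
        (Submodule.span_singleton_eq_span_singleton.2 ⟨a, rfl⟩).symm⟩
  rw [hset, Finset.sum_image]
  · simp only [hG, Finset.sum_const, Finset.card_univ, nsmul_eq_mul]
    refine Dvd.dvd.mul_right ?_ _
    rw [Fintype.card_units, Nat.card_eq_fintype_card, Nat.cast_sub Fintype.card_pos, Nat.cast_one]
  · intro a _ b _ hab
    exact Units.ext (smul_left_injective F hw0 hab)

end Counting

/-! ### Double counting and the modular condition -/

section DoubleCounting

theorem sum_fiber_sq {α β : Type*} [Fintype α] [Fintype β] [DecidableEq β] (g : α → β)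
    (a : α → ℤ) : ∑ c, (∑ P, if g P = c then a P else 0) ^ 2 =
      ∑ P, ∑ R, if g P = g R then a P * a R else 0 := by
  simp_rw [sq, Finset.sum_mul_sum]
  rw [Finset.sum_comm]
  refine Finset.sum_congr rfl fun P _ => ?_
  rw [Finset.sum_comm]
  refine Finset.sum_congr rfl fun R _ => ?_
  rw [Finset.sum_eq_single (g P)]
  · simp [eq_comm]
  · intro c _ hc
    simp [hc.symm]
  · simp

variable {F : Type*} [Field F] [Fintype F] [DecidableEq F]

theorem card_ne_zero_ker {w : Module.Dual F (AG3 F)} (hw : w ≠ 0) :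
    (((Finset.univ.erase (0 : AG3 F)).filter fun v => w v = 0).card : ℤ) =
      (Fintype.card F : ℤ) ^ 2 - 1 := by
  have h1 : ((Finset.univ.erase (0 : AG3 F)).filter fun v => w v = 0) =
      (Finset.univ.filter fun v => w v = 0).erase 0 := by
    ext v
    simp only [Finset.mem_filter, Finset.mem_erase, Finset.mem_univ, and_true, true_and]
  have h2 : (Finset.univ.filter fun v => w v = 0).card = {v | w v = 0}.ncard := by
    rw [← Set.ncard_coe_finset]
    simp
  rw [h1, Finset.card_erase_of_mem (by simp), Nat.cast_sub
    (Finset.card_pos.2 ⟨0, by simp⟩), h2, ncard_ker hw, Nat.card_eq_fintype_card]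
  push_cast; ring

theorem exists_ne_zero_apply_eq_zero (w : Module.Dual F (AG3 F)) : ∃ v, v ≠ 0 ∧ w v = 0 := by
  by_cases hw : w = 0
  · exact ⟨1, one_ne_zero, by simp [hw]⟩
  have h := card_ne_zero_ker hw
  have hq2 : (1 : ℤ) < Fintype.card F := by exact_mod_cast Fintype.one_lt_card (α := F)
  have hpos : 0 < ((Finset.univ.erase (0 : AG3 F)).filter fun v => w v = 0).card := by
    have : (0 : ℤ) < (Fintype.card F : ℤ) ^ 2 - 1 := by nlinarith
    rw [← h] at this
    exact_mod_cast this
  obtain ⟨v, hv⟩ := Finset.card_pos.1 hpos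
  have := Finset.mem_filter.1 hv
  exact ⟨v, (Finset.mem_erase.1 this.1).1, this.2⟩

theorem sum_line {v : AG3 F} (hv : v ≠ 0) (a : AG3 F → ℤ)
    (hinv : ∀ P, ∀ t : F, a (P + t • v) = a P) (P : AG3 F) :
    (∑ R, if ∃ t : F, t • v = R - P then a R else 0) = Fintype.card F * a P := by
  rw [← Finset.sum_filter]
  have : (Finset.univ.filter fun R => ∃ t : F, t • v = R - P) =
      Finset.univ.image fun t : F => P + t • v := by
    ext R
    simp only [Finset.mem_filter, Finset.mem_univ, true_and, Finset.mem_image]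
    exact exists_congr fun t => by rw [eq_sub_iff_add_eq, add_comm]
  rw [this, Finset.sum_image]
  · simp [hinv]
  · intro t _ r _ h
    exact smul_left_injective F hv (add_left_cancel h)

-- Here `f P v` models the indicator that the line through `P` along `v` is in the class, and `n w
-- c` the common line count in the plane w = c.
variable [Fintype (Module.Dual F (AG3 F))] [DecidableEq (Module.Dual F (AG3 F))]
  (f : AG3 F → AG3 F → ℤ) (n : Module.Dual F (AG3 F) → F → ℤ) (x : ℤ)

theorem card_dual_through_pair {v : AG3 F} (hv : v ≠ 0) (P R : AG3 F) :
    (((Finset.univ.erase (0 : Module.Dual F (AG3 F))).filter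
      fun w => w v = 0 ∧ w P = w R).card : ℤ) =
      (Fintype.card F - 1) + if ∃ t : F, t • v = R - P then
        ((Fintype.card F : ℤ) ^ 2 - Fintype.card F) else 0 := by
  have h1 : ((Finset.univ.erase (0 : Module.Dual F (AG3 F))).filter
      fun w => w v = 0 ∧ w P = w R) =
      (Finset.univ.filter fun w : Module.Dual F (AG3 F) => w v = 0 ∧ w (R - P) = 0).erase 0 := by
    ext w
    simp only [Finset.mem_filter, Finset.mem_erase, Finset.mem_univ, and_true, true_and, map_sub,
      sub_eq_zero, eq_comm (a := w P)]
  have h2 : (Finset.univ.filter fun w : Module.Dual F (AG3 F) => w v = 0 ∧ w (R - P) = 0).card =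
      {w : Module.Dual F (AG3 F) | w v = 0 ∧ w (R - P) = 0}.ncard := by
    rw [← Set.ncard_coe_finset]
    simp
  rw [h1, Finset.card_erase_of_mem (by simp), Nat.cast_sub
    (Finset.card_pos.2 ⟨0, by simp⟩), h2]
  split_ifs with h
  · rw [ncard_annihilator_pair_of_mem hv h, Nat.card_eq_fintype_card]
    push_cast; ring
  · rw [ncard_annihilator_pair_of_notMem hv h, Nat.card_eq_fintype_card]
    push_cast; ring

variable (hinv : ∀ P v, ∀ t : F, f (P + t • v) v = f P v) (h01 : ∀ P v, f P v * f P v = f P v)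
  (hx : ∀ v, v ≠ 0 → ∑ P, f P v = Fintype.card F * x)
  (hn : ∀ w, w ≠ 0 → ∀ c, ∀ v, v ≠ 0 → w v = 0 →
    (∑ P, if w P = c then f P v else 0) = Fintype.card F * n w c)

include hinv h01 hx in
-- Every pair of points has weight q-1, and pairs on a common line along `v` gain q²-q, giving
-- (q-1)(qx)² + (q²-q)·q·(qx).
theorem sum_dual_pairs {v : AG3 F} (hv : v ≠ 0) :
    (∑ w ∈ (Finset.univ.erase (0 : Module.Dual F (AG3 F))).filter (fun w => w v = 0),
      ∑ P, ∑ R, if w P = w R then f P v * f R v else 0) =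
      (Fintype.card F - 1) * Fintype.card F ^ 2 * (x * (x + Fintype.card F)) := by
  set q : ℤ := ((Fintype.card F : ℕ) : ℤ)
  have h1 : (∑ w ∈ (Finset.univ.erase (0 : Module.Dual F (AG3 F))).filter (fun w => w v = 0),
      ∑ P, ∑ R, if w P = w R then f P v * f R v else 0) =
      ∑ P, ∑ R, ((q - 1) + if ∃ t : F, t • v = R - P then q ^ 2 - q else 0) *
        (f P v * f R v) := by
    rw [Finset.sum_comm]
    refine Finset.sum_congr rfl fun P _ => ?_
    rw [Finset.sum_comm]
    refine Finset.sum_congr rfl fun R _ => ?_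
    rw [← card_dual_through_pair hv P R, ← Finset.sum_filter, Finset.filter_filter,
      Finset.sum_const, nsmul_eq_mul]
  have h2 : ∀ P, (∑ R, ((q - 1) + if ∃ t : F, t • v = R - P then q ^ 2 - q else 0) *
      (f P v * f R v)) = ((q - 1) * (q * x) + (q ^ 2 - q) * q) * f P v := by
    intro P
    have e : ∀ R, ((q - 1) + if ∃ t : F, t • v = R - P then q ^ 2 - q else 0) *
        (f P v * f R v) = (q - 1) * f P v * f R v +
          (q ^ 2 - q) * f P v * (if ∃ t : F, t • v = R - P then f R v else 0) := by
      intro R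
      split_ifs <;> ring
    rw [Finset.sum_congr rfl fun R _ => e R, Finset.sum_add_distrib, ← Finset.mul_sum,
      ← Finset.mul_sum, hx v hv, sum_line hv (fun R => f R v) (fun P t => hinv P v t)]
    linear_combination (q ^ 2 - q) * q * h01 P v
  rw [h1, Finset.sum_congr rfl fun P _ => h2 P, ← Finset.mul_sum, hx v hv]
  ring

include hinv h01 hx hn in
theorem sum_plane_sq :
    (Fintype.card F + 1) * ∑ w ∈ Finset.univ.erase (0 : Module.Dual F (AG3 F)), ∑ c, n w c ^ 2 =
      ((Fintype.card F : ℤ) ^ 3 - 1) * (x * (x + Fintype.card F)) := by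
  have hq2 : (1 : ℤ) < Fintype.card F := by exact_mod_cast Fintype.one_lt_card (α := F)
  set q : ℤ := ((Fintype.card F : ℕ) : ℤ)
  have h1 : (∑ w ∈ Finset.univ.erase (0 : Module.Dual F (AG3 F)),
      ∑ v ∈ (Finset.univ.erase (0 : AG3 F)).filter (fun v => w v = 0), ∑ c, (q * n w c) ^ 2) =
      (q ^ 2 - 1) * q ^ 2 *
        ∑ w ∈ Finset.univ.erase (0 : Module.Dual F (AG3 F)), ∑ c, n w c ^ 2 := by
    rw [Finset.mul_sum]
    refine Finset.sum_congr rfl fun w hw => ?_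
    rw [Finset.sum_const, nsmul_eq_mul, card_ne_zero_ker (Finset.mem_erase.1 hw).1]
    simp_rw [mul_pow]
    rw [← Finset.mul_sum]
    ring
  have h2 : (∑ w ∈ Finset.univ.erase (0 : Module.Dual F (AG3 F)),
      ∑ v ∈ (Finset.univ.erase (0 : AG3 F)).filter (fun v => w v = 0), ∑ c, (q * n w c) ^ 2) =
      ∑ v ∈ Finset.univ.erase (0 : AG3 F), (q - 1) * q ^ 2 * (x * (x + q)) := by
    simp_rw [Finset.sum_filter]
    rw [Finset.sum_comm]
    refine Finset.sum_congr rfl fun v hv => ?_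
    rw [← sum_dual_pairs f x hinv h01 hx (Finset.mem_erase.1 hv).1, Finset.sum_filter]
    refine Finset.sum_congr rfl fun w hw => ?_
    split_ifs with h
    · rw [← sum_fiber_sq (fun P => w P) fun P => f P v]
      refine Finset.sum_congr rfl fun c _ => ?_
      rw [hn w (Finset.mem_erase.1 hw).1 c v (Finset.mem_erase.1 hv).1 h]
    · rfl
  have h3 : ((Finset.univ.erase (0 : AG3 F)).card : ℤ) = q ^ 3 - 1 := by
    rw [Finset.card_erase_of_mem (Finset.mem_univ _), Finset.card_univ,
      Nat.cast_sub Fintype.card_pos, ← Nat.card_eq_fintype_card, card_AG3,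
      Nat.card_eq_fintype_card]
    push_cast; rfl
  rw [h1, Finset.sum_const, nsmul_eq_mul, h3] at h2
  have h4 : (q - 1) * q ^ 2 ≠ 0 := by
    have : 0 < q - 1 := by linarith
    positivity
  refine mul_left_cancel₀ h4 ?_
  linear_combination h2

include hx hn in
theorem sum_plane :
    ∑ w ∈ Finset.univ.erase (0 : Module.Dual F (AG3 F)), ∑ c, n w c =
      ((Fintype.card F : ℤ) ^ 3 - 1) * x := by
  have hq2 : (1 : ℤ) < Fintype.card F := by exact_mod_cast Fintype.one_lt_card (α := F)
  have h1 : ∀ w ∈ Finset.univ.erase (0 : Module.Dual F (AG3 F)), ∑ c, n w c = x := by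
    intro w hw
    -- The q parallel planes w = c partition the points, so their counts in one direction add up to
    -- x.
    obtain ⟨v, hv, hwv⟩ := exists_ne_zero_apply_eq_zero w
    refine mul_left_cancel₀ (by linarith : (Fintype.card F : ℤ) ≠ 0) ?_
    rw [← hx v hv, Finset.mul_sum]
    rw [Finset.sum_congr rfl fun c _ => (hn w (Finset.mem_erase.1 hw).1 c v hv hwv).symm,
      Finset.sum_comm]
    simp
  rw [Finset.sum_congr rfl h1, Finset.sum_const, nsmul_eq_mul]
  congr 1
  rw [Finset.card_erase_of_mem (Finset.mem_univ _), Finset.card_univ,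
    Nat.cast_sub Fintype.card_pos, Module.card_eq_pow_finrank (K := F),
    Subspace.dual_finrank_eq, Module.finrank_fin_fun]
  push_cast; rfl

include hinv h01 hx hn in
/-- The modular equality for Cameron-Liebler functions on `AG(3,q)`. -/
theorem two_mul_card_succ_dvd_of_incidence (hnn : ∀ w c, 0 ≤ n w c) :
    2 * ((Fintype.card F : ℤ) + 1) ∣ x * (x - 1) := by
  have hA := sum_plane_sq f n x hinv h01 hx hn
  have hB := sum_plane f n x hx hn
  have hq2 : (1 : ℤ) < Fintype.card F := by exact_mod_cast Fintype.one_lt_card (α := F)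
  set q : ℤ := ((Fintype.card F : ℕ) : ℤ) with hq
  have hscale : ∀ (a : Fˣ) (w : Module.Dual F (AG3 F)) (c : F), w ≠ 0 →
      n (a • w) (a • c) = n w c := by
    intro a w c hw
    obtain ⟨v, hv, hwv⟩ := exists_ne_zero_apply_eq_zero w
    refine mul_left_cancel₀ (by linarith : q ≠ 0) ?_
    rw [hq, ← hn w hw c v hv hwv, ← hn (a • w) ((smul_ne_zero_iff_ne a).2 hw) (a • c) v hv
      (by simp [hwv])]
    refine Finset.sum_congr rfl fun P _ => ?_
    have : (a • w) P = a • c ↔ w P = c := by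
      rw [LinearMap.smul_apply]
      exact (MulAction.injective a).eq_iff
    simp only [this]
  -- Since `n` is uncontrolled at w = 0, the value there is set to 0 to keep `g` invariant under
  -- scaling.
  let g : Module.Dual F (AG3 F) → ℤ := fun w =>
    if w = 0 then 0 else ∑ c, ((n w c).toNat.choose 2 : ℤ)
  obtain ⟨K, hK⟩ := card_sub_one_dvd_sum (F := F) g fun a w => by
    by_cases hw : w = 0
    · simp [hw]
    have haw : a • w ≠ 0 := (smul_ne_zero_iff_ne a).2 hw
    simp only [g, hw, haw, if_false]
    refine (Fintype.sum_equiv (MulAction.toPerm a) _ _ fun c => ?_).symm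
    rw [MulAction.toPerm_apply, hscale a w c hw]
  rw [Nat.card_eq_fintype_card, ← hq] at hK
  have hg : ∑ w ∈ Finset.univ.erase (0 : Module.Dual F (AG3 F)), ∑ c, n w c ^ 2 =
      2 * ∑ w ∈ Finset.univ.erase (0 : Module.Dual F (AG3 F)), g w +
        ∑ w ∈ Finset.univ.erase (0 : Module.Dual F (AG3 F)), ∑ c, n w c := by
    rw [Finset.mul_sum, ← Finset.sum_add_distrib]
    refine Finset.sum_congr rfl fun w hw => ?_
    simp only [g, (Finset.mem_erase.1 hw).1, if_false]
    rw [Finset.mul_sum, ← Finset.sum_add_distrib]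
    refine Finset.sum_congr rfl fun c _ => ?_
    obtain ⟨m, hm⟩ := Int.eq_ofNat_of_zero_le (hnn w c)
    rw [hm, Int.toNat_natCast]
    have h2 : m.choose 2 * 2 = m * (m - 1) := by
      rw [Nat.choose_two_right]
      exact Nat.div_mul_cancel (Nat.even_mul_pred_self m).two_dvd
    rcases m with _ | m
    · simp
    · rw [Nat.add_sub_cancel] at h2
      zify at h2
      push_cast
      linear_combination -h2
  have hmain : 2 * (q + 1) * K = (q ^ 2 + q + 1) * (x * (x - 1)) := by
    refine mul_left_cancel₀ (by linarith : q - 1 ≠ 0) ?_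
    rw [hg, hB, hK] at hA
    linear_combination hA
  -- q²+q+1 = q(q+1)+1 is odd and is 1 modulo q+1.
  have hcop : IsCoprime (2 * (q + 1)) (q ^ 2 + q + 1) := by
    refine IsCoprime.mul_left ?_ ⟨-q, 1, by ring⟩
    obtain ⟨r, hr⟩ := Int.even_mul_succ_self q
    exact ⟨-r, 1, by linear_combination hr⟩
  exact hcop.dvd_of_dvd_mul_left ⟨K, hmain.symm⟩

end DoubleCounting

/-! ### Application to Cameron-Liebler classes -/

section Parameters

variable {F : Type*} [Field F] [Finite F]

theorem IsCLLineClass.two_mul_card_succ_dvd {L : Set (AffineSubspace F (AG3 F))} {x : ℕ}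
    (hL : IsCLLineClass L x) : 2 * (Nat.card F + 1) ∣ x * (x - 1) := by
  classical
  have : Fintype F := Fintype.ofFinite F
  have : Finite (Module.Dual F (AG3 F)) := Module.finite_of_finite F
  have : Fintype (Module.Dual F (AG3 F)) := Fintype.ofFinite _
  have hex : ∀ w : Module.Dual F (AG3 F), ∀ c, ∃ m : ℕ, w ≠ 0 → ∀ v, v ≠ 0 → w v = 0 →
      {P | w P = c ∧ lineThrough P v ∈ L}.ncard = Nat.card F * m := by
    intro w c
    obtain ⟨u, hu, hwu⟩ := exists_ne_zero_apply_eq_zero w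
    obtain ⟨m, hm⟩ := card_dvd_ncard_plane (L := L) c hu hwu
    exact ⟨m, fun _ v hv hwv => by rw [← hm, hL.ncard_plane_eq c hv hu hwv hwu]⟩
  choose n hn using hex
  have key := two_mul_card_succ_dvd_of_incidence
    (fun P v => if lineThrough P v ∈ L then (1 : ℤ) else 0) (fun w c => (n w c : ℤ)) (x : ℤ)
    (fun P v t => by
      rw [lineThrough_eq_of_mem (P := P) (mem_lineThrough.2 ⟨t, (add_sub_cancel_left _ _).symm⟩)])
    (fun P v => by split_ifs <;> rfl)
    (fun v hv => by
      have h := hL.ncard_direction hv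
      rw [Set.ncard_eq_toFinset_card', Nat.card_eq_fintype_card] at h
      rw [Finset.sum_boole, ← Nat.cast_mul, ← h]
      simp)
    (fun w hw c v hv hwv => by
      have h := hn w c hw v hv hwv
      rw [Set.ncard_eq_toFinset_card', Nat.card_eq_fintype_card] at h
      simp_rw [← ite_and]
      rw [Finset.sum_boole, ← Nat.cast_mul, ← h]
      simp)
    fun _ _ => Int.natCast_nonneg _
  rw [Nat.card_eq_fintype_card]
  rcases x with _ | x
  · simp
  · rw [Nat.add_sub_cancel]
    zify
    simpa using key

end Parameters

theorem theorem5p2 (F : Type*) [Field F] [Finite F] (q : ℕ) (hq : Nat.card F = q)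
    (s : ℕ) (p h : Fin s → ℕ) (hp : ∀ i, (p i).Prime) (hinj : Function.Injective p)
    (hh : ∀ i, 0 < h i) (hfac : 2 * (q + 1) = ∏ i, p i ^ h i) :
    (∀ x ∈ clParameters F, x ≤ q ^ 2) ∧
    (Even q → ((clParameters F).ncard : ℤ) ≤ 2 ^ (s - 1) * q) ∧
    (Odd q → ((clParameters F).ncard : ℤ) ≤ 2 ^ (s - 1) * q - 2 ^ (s - 1) + 2) := by
  subst hq
  have hle : ∀ x ∈ clParameters F, x ≤ Nat.card F ^ 2 := fun x ⟨L, hL⟩ => hL.le_card_sq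
  have hfin : (clParameters F).Finite := (Set.finite_Iic _).subset hle
  have hq : 1 < Nat.card F := Finite.one_lt_card
  obtain ⟨hcard, hs⟩ := card_le_of_two_mul_succ_dvd hq p h hp hinj hfac hfin.toFinset
    fun x hx => ⟨hle x (hfin.mem_toFinset.1 hx), by
      obtain ⟨L, hL⟩ := hfin.mem_toFinset.1 hx
      exact hL.two_mul_card_succ_dvd⟩
  rw [← Set.ncard_eq_toFinset_card _ hfin] at hcard
  zify [hq.le] at hcard
  refine ⟨hle, fun he => ?_, fun _ => by linarith⟩
  -- For even q, q+1 has an odd prime factor, so s ≥ 2 and the extra 2 is absorbed into 2^(s-1).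
  have h2 : (2 : ℤ) ≤ 2 ^ (s - 1) :=
    le_self_pow₀ (by norm_num) (Nat.sub_pos_of_lt (hs he)).ne'
  linarith
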